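/- An ai-semiring is a nonempty set with two associative binary operations $+$ and $\cdot$ such that $+$ is commutative and idempotent and $\cdot$ distributes over $+$ on both sides. A variety is a class of ai-semirings closed under homomorphic images, (isomorphic copies of) subsemirings and direct products, and $\mathbf V(K)$ is the smallest variety containing the class $K$; write $\mathbf V(S)=\mathbf V(\{S\})$. By a 3-uniform hypergraph we mean a finite hypergraph $\mathbb H=(V,E)$ with $E\neq\emptyset$, without isolated vertices, all of whose hyperedges have exactly 3 elements, and which is linear (two distinct hyperedges have at most one common vertex). Its hypergraph semigroup is presented by the generators $0$ and $\mathbf a_v$ ($v\in V$) and the relations: $\mathbf a_u\mathbf a_v=\mathbf a_v\mathbf a_u$; all products $\mathbf a_u\mathbf a_v\mathbf a_w$ with $\{u,v,w\}\in E$ are equal; $\mathbf a_u\mathbf a_v\mathbf a_w=0$ if $\{u,v,w\}\notin E$; $\mathbf a_u\mathbf a_v=0$ if $u=v$ or $\{u,v\}$ is contained in no hyperedge; $0\mathbf a_u=\mathbf a_u0=00=0$; and $\mathbf a_u\mathbf a_v=\mathbf a_r\mathbf a_s$ if $\{u,v,h\},\{r,s,h\}\in E$ for some $h\in V$. The hypergraph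 semiring $S_{\mathbb H}$ is this semigroup with the flat addition $x+x=x$ and $x+y=0$ for $x\neq y$; it is an ai-semiring. For $i\ge 1$ let $\mathbb N_i$ be the nested-type 3-hypergraph with vertices $u_1,\dots,u_{3i+3}$ and hyperedges $$\{u_{3j-1},u_{3j+3},u_{3j-2}\},\quad \{u_{3j-2},u_{3j+2},u_{3j}\},\quad \{u_{3j},u_{3j+1},u_{3j-1}\}\qquad(1\le j\le i),$$ and for $j\ge 1$ put $$p_j=x_{3j-1}x_{3j+3}x_{3j-2}+x_{3j-2}x_{3j+2}x_{3j}+x_{3j}x_{3j+1}x_{3j-1},\qquad q_j=(x_{3j-1}+x_{3j+2})(x_{3j-2}+x_{3j+1})(x_{3j}+x_{3j+3}).$$ Then: 1. $\mathbf V(S_{\mathbb N_i})\subsetneq \mathbf V(S_{\mathbb N_{i+1}})$ for all $i\ge 1$. 2. Each $\mathbf V(S_{\mathbb N_i})$ is a subvariety of the variety generated by all 3-uniform hypergraph semirings. 3. The variety generated by all 3-uniform hypergraph semirings has infinitely many subvarieties. 4. For all $i\ge 1$, the identity $\sum_{j=1}^{i+1}p_j\approx\sum_{j=1}^{i+1}q_j$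 holds in $S_{\mathbb N_i}$ but fails in $S_{\mathbb N_{i+1}}$. -/

import Mathlib

/-! # Additively idempotent semirings and their varieties -/

/-- An additively idempotent semiring (ai-semiring): two associative binary operations, addition
commutative and idempotent, multiplication distributing over addition on both sides. -/
class AISemiring (S : Type) extends AddCommSemigroup S, Semigroup S, Distrib S where
  add_idem : ∀ a : S, a + a = a

namespace AISemiring

/-- A (nonempty) ai-semiring, bundled with its carrier. -/
structure Bundled : Type 1 where
  carrier : Type
  [str : AISemiring carrier]
  [nonempty : Nonempty carrier]

attribute [instance] Bundled.str Bundled.nonempty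

/-- A homomorphism of ai-semirings: a map preserving addition and multiplication. -/
structure IsHom {A B : Type} [AISemiring A] [AISemiring B] (f : A → B) : Prop where
  map_add : ∀ x y, f (x + y) = f x + f y
  map_mul : ∀ x y, f (x * y) = f x * f y

/-- The direct product, with the coordinatewise operations. -/
instance instPi {I : Type} (A : I → Type) [∀ i, AISemiring (A i)] : AISemiring (∀ i, A i) where
  add f g := fun i => f i + g i
  mul f g := fun i => f i * g i
  add_assoc f g h := funext fun i => add_assoc (f i) (g i) (h i)
  add_comm f g := funext fun i => add_comm (f i) (g i)
  mul_assoc f g h := funext fun i => mul_assoc (f i) (g i) (h i)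
  left_distrib f g h := funext fun i => mul_add (f i) (g i) (h i)
  right_distrib f g h := funext fun i => add_mul (f i) (g i) (h i)
  add_idem f := funext fun i => add_idem (f i)

/-- A variety: a class of ai-semirings closed under homomorphic images, under (isomorphic copies
of) subsemirings and under arbitrary direct products. -/
structure IsVariety (W : Set Bundled) : Prop where
  image : ∀ A B : Bundled, A ∈ W →
    (∃ f : A.carrier → B.carrier, IsHom f ∧ Function.Surjective f) → B ∈ W
  sub : ∀ A B : Bundled, A ∈ W →
    (∃ f : B.carrier → A.carrier, IsHom f ∧ Function.Injective f) → B ∈ W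
  prod : ∀ (I : Type) (A : I → Bundled), (∀ i, A i ∈ W) →
    (⟨∀ i, (A i).carrier⟩ : Bundled) ∈ W

/-- The variety generated by a class `K`: the smallest variety containing `K`. -/
def variety (K : Set Bundled) : Set Bundled := ⋂₀ {W | IsVariety W ∧ K ⊆ W}

/-- Semiring terms in the variables `x₀, x₁, x₂, …`. -/
inductive Expr : Type where
  | var : ℕ → Expr
  | add : Expr → Expr → Expr
  | mul : Expr → Expr → Expr

instance : Add Expr := ⟨Expr.add⟩
instance : Mul Expr := ⟨Expr.mul⟩

/-- The value of a term under a substitution. -/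
def Expr.eval {S : Type} [AISemiring S] (φ : ℕ → S) : Expr → S
  | .var n => φ n
  | .add s t => s.eval φ + t.eval φ
  | .mul s t => s.eval φ * t.eval φ

/-- `S` satisfies the identity `s ≈ t`. -/
def Satisfies (S : Bundled) (s t : Expr) : Prop :=
  ∀ φ : ℕ → S.carrier, s.eval φ = t.eval φ

/-- `Expr.sum f n` is the term `f 1 + f 2 + ⋯ + f (n + 1)`. -/
def Expr.sum (f : ℕ → Expr) : ℕ → Expr
  | 0 => f 1
  | n + 1 => Expr.sum f n + f (n + 2)

/-- `p_j = x_{3j-1} x_{3j+3} x_{3j-2} + x_{3j-2} x_{3j+2} x_{3j} + x_{3j} x_{3j+1} x_{3j-1}`,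
for `j ≥ 1`. -/
def pExpr (j : ℕ) : Expr :=
  .var (3 * j - 1) * .var (3 * j + 3) * .var (3 * j - 2) +
  .var (3 * j - 2) * .var (3 * j + 2) * .var (3 * j) +
  .var (3 * j) * .var (3 * j + 1) * .var (3 * j - 1)

/-- `q_j = (x_{3j-1} + x_{3j+2}) (x_{3j-2} + x_{3j+1}) (x_{3j} + x_{3j+3})`, for `j ≥ 1`. -/
def qExpr (j : ℕ) : Expr :=
  (.var (3 * j - 1) + .var (3 * j + 2)) * (.var (3 * j - 2) + .var (3 * j + 1)) *
    (.var (3 * j) + .var (3 * j + 3))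

end AISemiring

/-! # 3-uniform hypergraphs and their semirings -/

/-- A finite linear 3-uniform hypergraph with at least one hyperedge and no isolated vertices. -/
structure Hypergraph3 : Type 1 where
  V : Type
  finite : Finite V
  edges : Set (Set V)
  uniform : ∀ e ∈ edges, e.ncard = 3
  linear : ∀ e ∈ edges, ∀ f ∈ edges, e ≠ f → (e ∩ f).Subsingleton
  no_isolated : ∀ v, ∃ e ∈ edges, v ∈ e
  nonempty : edges.Nonempty

namespace Hypergraph3

/-- The generators: `0` and `a_v` for each vertex `v`. -/
inductive Gen (H : Hypergraph3) : Type where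
  | zero : Gen H
  | vert : H.V → Gen H

/-- The word `0` of length one. -/
def wz (H : Hypergraph3) : FreeSemigroup H.Gen := FreeSemigroup.of .zero

/-- The word `a_v` of length one. -/
def wa (H : Hypergraph3) (v : H.V) : FreeSemigroup H.Gen := FreeSemigroup.of (.vert v)

/-- The defining relations of the hypergraph semigroup. -/
inductive Rel (H : Hypergraph3) : FreeSemigroup H.Gen → FreeSemigroup H.Gen → Prop
  | comm (u v : H.V) : Rel H (H.wa u * H.wa v) (H.wa v * H.wa u)
  /-- all products along hyperedges are equal (to the element written `a`) -/
  | edge (u v w u' v' w' : H.V) : {u, v, w} ∈ H.edges → {u', v', w'} ∈ H.edges →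
      Rel H (H.wa u * H.wa v * H.wa w) (H.wa u' * H.wa v' * H.wa w')
  | non_edge (u v w : H.V) : {u, v, w} ∉ H.edges → Rel H (H.wa u * H.wa v * H.wa w) H.wz
  | non_sub (u v : H.V) : (u = v ∨ ¬ ∃ e ∈ H.edges, {u, v} ⊆ e) →
      Rel H (H.wa u * H.wa v) H.wz
  | zero_vert (u : H.V) : Rel H (H.wz * H.wa u) H.wz
  | vert_zero (u : H.V) : Rel H (H.wa u * H.wz) H.wz
  | zero_zero : Rel H (H.wz * H.wz) H.wz
  /-- `{u, v}` and `{r, s}` are linked: one vertex `h` completes both to hyperedges -/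
  | linked (u v r s h : H.V) : {u, v, h} ∈ H.edges → {r, s, h} ∈ H.edges →
      Rel H (H.wa u * H.wa v) (H.wa r * H.wa s)

/-- The hypergraph semigroup, presented by the generators and relations above. -/
def SG (H : Hypergraph3) : Type := (conGen H.Rel).Quotient

instance (H : Hypergraph3) : Semigroup H.SG := inferInstanceAs (Semigroup (conGen H.Rel).Quotient)

/-- The class of a word. -/
def SG.mk (H : Hypergraph3) (x : FreeSemigroup H.Gen) : H.SG := (x : (conGen H.Rel).Quotient)

instance (H : Hypergraph3) : Zero H.SG := ⟨SG.mk H H.wz⟩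

/-- The flat addition: `x + x = x`, and `x + y = 0` for `x ≠ y`. -/
noncomputable instance (H : Hypergraph3) : Add H.SG :=
  ⟨fun x y => open Classical in if x = y then x else 0⟩

/-! The hypergraph semigroup is 0-cancellative, so that the flat addition makes it an ai-semiring.
This is seen on an explicit list of its elements. -/

theorem ne_of_edge (H : Hypergraph3) {u v w : H.V} (h : {u, v, w} ∈ H.edges) :
    u ≠ v ∧ u ≠ w ∧ v ≠ w := by
  have k3 := H.uniform _ h
  have pr : ∀ x y : H.V, ({x, y} : Set H.V).ncard ≤ 2 := fun x y =>
    (Set.ncard_insert_le _ _).trans (by simp)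
  refine ⟨?_, ?_, ?_⟩ <;> rintro rfl
  · have := pr u w; simp at k3; omega
  · have := pr u v
    rw [show ({u, v, u} : Set H.V) = {u, v} by ext; simp; tauto] at k3; omega
  · have := pr u v; simp at k3; omega

theorem third_unique (H : Hypergraph3) {u v w w' : H.V} (h : {u, v, w} ∈ H.edges)
    (h' : {u, v, w'} ∈ H.edges) : w = w' := by
  have h2 := H.ne_of_edge h
  by_cases he : ({u, v, w} : Set H.V) = {u, v, w'}
  · have hw : w ∈ ({u, v, w'} : Set H.V) := he ▸ by simp
    simp only [Set.mem_insert_iff, Set.mem_singleton_iff] at hw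
    rcases hw with rfl | rfl | rfl
    · exact absurd rfl h2.2.1
    · exact absurd rfl h2.2.2
    · rfl
  · exact absurd (H.linear _ h _ h' he (x := u) (by simp) (y := v) (by simp)) h2.1

theorem swap_edge (H : Hypergraph3) {u v w : H.V} :
    {u, v, w} ∈ H.edges ↔ {v, u, w} ∈ H.edges := by
  rw [Set.insert_comm]

theorem rot_edge (H : Hypergraph3) {u v w : H.V} :
    {u, v, w} ∈ H.edges ↔ {v, w, u} ∈ H.edges := by
  rw [show ({u, v, w} : Set H.V) = {v, w, u} by ext; simp; tauto]

/-- The elements of the hypergraph semigroup: `0`, the `a_v`, the products of two distinct vertices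
of a hyperedge (labelled by the third vertex) and the products along hyperedges. -/
inductive Elt (H : Hypergraph3) : Type where
  | zero : Elt H
  | vert : H.V → Elt H
  | pair : H.V → Elt H
  | top : Elt H

open Classical in
/-- The multiplication on the list of elements. -/
noncomputable def Elt.mul {H : Hypergraph3} : Elt H → Elt H → Elt H
  | .vert u, .vert v => if h : ∃ w, {u, v, w} ∈ H.edges then .pair h.choose else .zero
  | .vert u, .pair v => if u = v then .top else .zero
  | .pair u, .vert v => if u = v then .top else .zero
  | _, _ => .zero

theorem Elt.vv {H : Hypergraph3} {u v w : H.V} (h : {u, v, w} ∈ H.edges) :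
    Elt.mul (.vert u) (.vert v) = .pair w := by
  have hx : ∃ w, {u, v, w} ∈ H.edges := ⟨w, h⟩
  simp only [Elt.mul, dif_pos hx]
  rw [H.third_unique hx.choose_spec h]

theorem Elt.vv0 {H : Hypergraph3} {u v : H.V} (h : ¬ ∃ w, {u, v, w} ∈ H.edges) :
    Elt.mul (.vert u) (.vert v) = .zero := by
  simp only [Elt.mul, dif_neg h]

theorem Elt.vvv {H : Hypergraph3} (u v w : H.V) :
    Elt.mul (Elt.mul (.vert u) (.vert v)) (.vert w) =
      open Classical in if {u, v, w} ∈ H.edges then .top else .zero := by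
  by_cases h : ∃ w, {u, v, w} ∈ H.edges
  · obtain ⟨x, hx⟩ := h
    rw [Elt.vv hx]
    by_cases hw : x = w
    · subst hw; simp [Elt.mul, hx]
    · have : {u, v, w} ∉ H.edges := fun h' => hw (H.third_unique hx h')
      simp [Elt.mul, hw, this]
  · have : {u, v, w} ∉ H.edges := fun h' => h ⟨w, h'⟩
    rw [Elt.vv0 h]; simp [Elt.mul, this]

theorem Elt.vvv' {H : Hypergraph3} (u v w : H.V) :
    Elt.mul (.vert u) (Elt.mul (.vert v) (.vert w)) =
      open Classical in if {u, v, w} ∈ H.edges then .top else .zero := by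
  by_cases h : ∃ u, {v, w, u} ∈ H.edges
  · obtain ⟨x, hx⟩ := h
    rw [Elt.vv hx]
    by_cases hw : u = x
    · subst hw
      have : {u, v, w} ∈ H.edges := H.rot_edge.2 hx
      simp [Elt.mul, this]
    · have : {u, v, w} ∉ H.edges := fun h' => hw (H.third_unique (H.rot_edge.1 h') hx)
      simp [Elt.mul, hw, this]
  · have : {u, v, w} ∉ H.edges := fun h' => h ⟨u, H.rot_edge.1 h'⟩
    rw [Elt.vv0 h]; simp [Elt.mul, this]

noncomputable instance (H : Hypergraph3) : Semigroup (Elt H) where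
  mul := Elt.mul
  mul_assoc x y z := by
    change Elt.mul (Elt.mul x y) z = Elt.mul x (Elt.mul y z)
    rcases x with _ | u | u | _ <;> rcases y with _ | v | v | _ <;> rcases z with _ | w | w | _ <;>
      first
      | rw [Elt.vvv, Elt.vvv']
      | (simp only [Elt.mul]; done)
      | (simp only [Elt.mul]; split_ifs <;> rfl)

theorem Elt.mul_def {H : Hypergraph3} (x y : Elt H) : x * y = Elt.mul x y := rfl

/-- Evaluation of words in the list of elements. -/
noncomputable def evalW (H : Hypergraph3) : FreeSemigroup H.Gen →ₙ* Elt H :=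
  FreeSemigroup.lift fun g => match g with
    | .zero => .zero
    | .vert v => .vert v

theorem evalW_wa (H : Hypergraph3) (v : H.V) : H.evalW (H.wa v) = .vert v := rfl

theorem evalW_wz (H : Hypergraph3) : H.evalW H.wz = .zero := rfl

theorem exists_third (H : Hypergraph3) {e : Set H.V} (he : e ∈ H.edges) {u v : H.V}
    (hu : u ∈ e) (hv : v ∈ e) (huv : u ≠ v) : ∃ w, {u, v, w} ∈ H.edges := by
  obtain ⟨x, y, z, -, -, -, rfl⟩ := Set.ncard_eq_three.1 (H.uniform e he)
  simp only [Set.mem_insert_iff, Set.mem_singleton_iff] at hu hv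
  have key : ∀ t : H.V, ({u, v, t} : Set H.V) = {x, y, z} → ∃ w, {u, v, w} ∈ H.edges :=
    fun t ht => ⟨t, ht ▸ he⟩
  rcases hu with rfl | rfl | rfl <;> rcases hv with rfl | rfl | rfl <;>
    first
    | exact absurd rfl huv
    | (refine key z ?_; ext; simp; done)
    | (refine key z ?_; ext; simp; tauto)
    | (refine key y ?_; ext; simp; tauto)
    | (refine key x ?_; ext; simp; tauto)

theorem evalW_rel (H : Hypergraph3) {x y : FreeSemigroup H.Gen} (h : H.Rel x y) :
    H.evalW x = H.evalW y := by
  induction h with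
  | comm u v =>
    simp only [map_mul, evalW_wa, Elt.mul_def]
    by_cases h : ∃ w, {u, v, w} ∈ H.edges
    · obtain ⟨w, hw⟩ := h
      rw [Elt.vv hw, Elt.vv (H.swap_edge.1 hw)]
    · rw [Elt.vv0 h, Elt.vv0 fun ⟨w, hw⟩ => h ⟨w, H.swap_edge.1 hw⟩]
  | edge u v w u' v' w' h h' =>
    simp only [map_mul, evalW_wa, Elt.mul_def, Elt.vvv, h, h']
  | non_edge u v w h =>
    simp only [map_mul, evalW_wa, evalW_wz, Elt.mul_def, Elt.vvv, h, if_false]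
  | non_sub u v h =>
    simp only [map_mul, evalW_wa, evalW_wz, Elt.mul_def]
    refine Elt.vv0 fun ⟨w, hw⟩ => ?_
    rcases h with h | h
    · exact (H.ne_of_edge hw).1 h
    · exact h ⟨_, hw, by intro t; simp; tauto⟩
  | zero_vert u => rfl
  | vert_zero u => rfl
  | zero_zero => rfl
  | linked u v r s h h1 h2 =>
    simp only [map_mul, evalW_wa, Elt.mul_def, Elt.vv h1, Elt.vv h2]

theorem SG.mk_mul (H : Hypergraph3) (x y : FreeSemigroup H.Gen) :
    SG.mk H (x * y) = SG.mk H x * SG.mk H y := rfl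

theorem SG.mk_rel (H : Hypergraph3) {x y : FreeSemigroup H.Gen} (h : H.Rel x y) :
    SG.mk H x = SG.mk H y :=
  (Con.eq _).2 (ConGen.Rel.of _ _ h)

theorem SG.mk_surjective (H : Hypergraph3) : Function.Surjective (SG.mk H) := fun x =>
  Con.induction_on x fun w => ⟨w, rfl⟩

/-- The element `a_v` of the hypergraph semigroup. -/
def SG.a (H : Hypergraph3) (v : H.V) : H.SG := SG.mk H (H.wa v)

/-- The map from the hypergraph semigroup to the list of elements. -/
noncomputable def SG.toElt (H : Hypergraph3) (x : H.SG) : Elt H :=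
  Con.liftOn (c := conGen H.Rel) x H.evalW fun _ _ h =>
    (Con.conGen_le (c := Con.ker H.evalW)).2 (fun _ _ => H.evalW_rel) h

theorem SG.toElt_mk (H : Hypergraph3) (x : FreeSemigroup H.Gen) :
    SG.toElt H (SG.mk H x) = H.evalW x := rfl

theorem SG.toElt_mul (H : Hypergraph3) (x y : H.SG) :
    SG.toElt H (x * y) = SG.toElt H x * SG.toElt H y := by
  obtain ⟨x, rfl⟩ := SG.mk_surjective H x
  obtain ⟨y, rfl⟩ := SG.mk_surjective H y
  rw [← SG.mk_mul, SG.toElt_mk, SG.toElt_mk, SG.toElt_mk, map_mul]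

open Classical in
/-- The map from the list of elements to the hypergraph semigroup. -/
noncomputable def Elt.toSG {H : Hypergraph3} : Elt H → H.SG
  | .zero => 0
  | .vert v => SG.a H v
  | .pair w => if h : ∃ p : H.V × H.V, {p.1, p.2, w} ∈ H.edges then
      SG.a H h.choose.1 * SG.a H h.choose.2 else 0
  | .top => if h : ∃ p : H.V × H.V × H.V, {p.1, p.2.1, p.2.2} ∈ H.edges then
      SG.a H h.choose.1 * SG.a H h.choose.2.1 * SG.a H h.choose.2.2 else 0

theorem Elt.toSG_pair {H : Hypergraph3} {u v w : H.V} (h : {u, v, w} ∈ H.edges) :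
    Elt.toSG (.pair w) = SG.a H u * SG.a H v := by
  have hx : ∃ p : H.V × H.V, {p.1, p.2, w} ∈ H.edges := ⟨(u, v), h⟩
  simp only [Elt.toSG, dif_pos hx]
  exact SG.mk_rel H (.linked _ _ _ _ _ hx.choose_spec h)

theorem Elt.toSG_top {H : Hypergraph3} {u v w : H.V} (h : {u, v, w} ∈ H.edges) :
    Elt.toSG .top = SG.a H u * SG.a H v * SG.a H w := by
  have hx : ∃ p : H.V × H.V × H.V, {p.1, p.2.1, p.2.2} ∈ H.edges := ⟨(u, v, w), h⟩
  simp only [Elt.toSG, dif_pos hx]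
  exact SG.mk_rel H (.edge _ _ _ _ _ _ hx.choose_spec h)

theorem SG.zero_mul' (H : Hypergraph3) (x : H.SG) : 0 * x = 0 := by
  obtain ⟨x, rfl⟩ := SG.mk_surjective H x
  induction x using FreeSemigroup.recOnMul with
  | ih1 g =>
    cases g with
    | zero => exact SG.mk_rel H .zero_zero
    | vert v => exact SG.mk_rel H (.zero_vert v)
  | ih2 g y h1 h2 => rw [SG.mk_mul, ← mul_assoc, h1, h2]

theorem SG.mul_zero' (H : Hypergraph3) (x : H.SG) : x * 0 = 0 := by
  obtain ⟨x, rfl⟩ := SG.mk_surjective H x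
  induction x using FreeSemigroup.recOnMul with
  | ih1 g =>
    cases g with
    | zero => exact SG.mk_rel H .zero_zero
    | vert v => exact SG.mk_rel H (.vert_zero v)
  | ih2 g y h1 h2 => rw [SG.mk_mul, mul_assoc, h2, h1]

theorem SG.a_comm (H : Hypergraph3) (u v : H.V) : SG.a H u * SG.a H v = SG.a H v * SG.a H u :=
  SG.mk_rel H (.comm u v)

theorem SG.a_zero (H : Hypergraph3) {u v w : H.V} (h : {u, v, w} ∉ H.edges) :
    SG.a H u * SG.a H v * SG.a H w = 0 :=
  SG.mk_rel H (.non_edge u v w h)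

theorem SG.four (H : Hypergraph3) (u x y z : H.V) :
    SG.a H u * SG.a H x * SG.a H y * SG.a H z = 0 := by
  by_cases h1 : {u, x, y} ∈ H.edges
  · by_cases h2 : {u, x, z} ∈ H.edges
    · obtain rfl := H.third_unique h1 h2
      have h3 : {x, y, y} ∉ H.edges := fun h => (H.ne_of_edge h).2.2 rfl
      rw [mul_assoc, mul_assoc, ← mul_assoc (SG.a H x), SG.a_zero H h3, SG.mul_zero']
    · rw [mul_assoc, SG.a_comm H y z, ← mul_assoc, SG.a_zero H h2, SG.zero_mul']
  · rw [SG.a_zero H h1, SG.zero_mul']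

theorem exists_pair (H : Hypergraph3) (w : H.V) : ∃ u v, {u, v, w} ∈ H.edges := by
  obtain ⟨e, he, hw⟩ := H.no_isolated w
  obtain ⟨x, y, z, hxy, hxz, -, rfl⟩ := Set.ncard_eq_three.1 (H.uniform e he)
  simp only [Set.mem_insert_iff, Set.mem_singleton_iff] at hw
  rcases hw with rfl | rfl | rfl
  · exact ⟨y, z, H.rot_edge.1 he⟩
  · exact ⟨z, x, H.rot_edge.2 he⟩
  · exact ⟨x, y, he⟩

theorem exists_edge (H : Hypergraph3) : ∃ u v w, {u, v, w} ∈ H.edges := by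
  obtain ⟨e, he⟩ := H.nonempty
  obtain ⟨x, y, z, -, -, -, rfl⟩ := Set.ncard_eq_three.1 (H.uniform e he)
  exact ⟨x, y, z, he⟩

theorem Elt.toSG_mul {H : Hypergraph3} (x y : Elt H) :
    Elt.toSG (x * y) = Elt.toSG x * Elt.toSG y := by
  obtain ⟨a, b, c, hT⟩ := H.exists_edge
  rw [Elt.mul_def]
  have h0 : Elt.toSG (.zero : Elt H) = 0 := rfl
  have hv : ∀ u : H.V, Elt.toSG (.vert u) = SG.a H u := fun _ => rfl
  rcases x with _ | u | u | _ <;> rcases y with _ | v | v | _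
  case vert.vert =>
    by_cases h : ∃ w, {u, v, w} ∈ H.edges
    · obtain ⟨w, hw⟩ := h
      rw [Elt.vv hw, Elt.toSG_pair hw]; rfl
    · rw [Elt.vv0 h]
      refine (SG.mk_rel H (.non_sub u v ?_)).symm
      by_contra! hc
      obtain ⟨e, he, hs⟩ := hc.2
      exact h (H.exists_third he (hs (by simp)) (hs (by simp)) hc.1)
  case vert.pair =>
    obtain ⟨p, q, hpq⟩ := H.exists_pair v
    rw [Elt.toSG_pair hpq, hv, ← mul_assoc]
    by_cases h : u = v
    · subst h
      simp only [Elt.mul, if_true]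
      exact Elt.toSG_top (H.rot_edge.2 hpq)
    · simp only [Elt.mul, if_neg h]
      exact (SG.a_zero H fun h' => h (H.third_unique (H.rot_edge.1 h') hpq)).symm
  case pair.vert =>
    obtain ⟨p, q, hpq⟩ := H.exists_pair u
    rw [Elt.toSG_pair hpq, hv]
    by_cases h : u = v
    · subst h
      simp only [Elt.mul, if_true]
      exact Elt.toSG_top hpq
    · simp only [Elt.mul, if_neg h]
      exact (SG.a_zero H fun h' => h (H.third_unique hpq h')).symm
  case pair.pair =>
    obtain ⟨p, q, hpq⟩ := H.exists_pair u
    obtain ⟨r, s, hrs⟩ := H.exists_pair v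
    rw [Elt.toSG_pair hpq, Elt.toSG_pair hrs, ← mul_assoc, SG.four]; rfl
  case vert.top =>
    rw [Elt.toSG_top hT, hv, ← mul_assoc, ← mul_assoc, SG.four]; rfl
  case top.vert =>
    rw [Elt.toSG_top hT, hv, SG.four]; rfl
  case pair.top =>
    obtain ⟨p, q, hpq⟩ := H.exists_pair u
    rw [Elt.toSG_top hT, Elt.toSG_pair hpq, ← mul_assoc, ← mul_assoc, SG.four, SG.zero_mul']; rfl
  case top.pair =>
    obtain ⟨p, q, hpq⟩ := H.exists_pair v
    rw [Elt.toSG_top hT, Elt.toSG_pair hpq, ← mul_assoc, SG.four, SG.zero_mul']; rfl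
  case top.top =>
    rw [Elt.toSG_top hT, ← mul_assoc, ← mul_assoc, SG.four, SG.zero_mul', SG.zero_mul']; rfl
  all_goals
    simp only [h0, SG.zero_mul', SG.mul_zero', Elt.mul]

theorem SG.toSG_toElt (H : Hypergraph3) (x : H.SG) : (SG.toElt H x).toSG = x := by
  obtain ⟨x, rfl⟩ := SG.mk_surjective H x
  induction x using FreeSemigroup.recOnMul with
  | ih1 g => cases g <;> rfl
  | ih2 g y h1 h2 => rw [SG.mk_mul, SG.toElt_mul, Elt.toSG_mul, h1, h2]

theorem SG.toElt_injective (H : Hypergraph3) : Function.Injective (SG.toElt H) :=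
  Function.LeftInverse.injective (SG.toSG_toElt H)

theorem Elt.cancel {H : Hypergraph3} {x y z : Elt H} (h : x * y = x * z) (h0 : x * y ≠ .zero) :
    y = z := by
  simp only [Elt.mul_def] at h h0
  have key : ∀ u v : H.V, Elt.mul (.vert u) (.vert v) ≠ .zero →
      ∃ w, {u, v, w} ∈ H.edges ∧ Elt.mul (.vert u) (.vert v) = .pair w := by
    intro u v hn
    by_cases hw : ∃ w, {u, v, w} ∈ H.edges
    · obtain ⟨w, hw⟩ := hw
      exact ⟨w, hw, Elt.vv hw⟩
    · exact absurd (Elt.vv0 hw) hn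
  rcases x with _ | u | u | _ <;> rcases y with _ | v | v | _ <;> rcases z with _ | w | w | _
  case vert.vert.vert =>
    obtain ⟨t, ht, e1⟩ := key u v h0
    obtain ⟨t', ht', e2⟩ := key u w (h ▸ h0)
    rw [e1, e2] at h
    injection h with h
    subst h
    have s1 : {u, t, v} ∈ H.edges := by rw [Set.pair_comm t v]; exact ht
    have s2 : {u, t, w} ∈ H.edges := by rw [Set.pair_comm t w]; exact ht'
    rw [H.third_unique s1 s2]
  case vert.vert.pair =>
    obtain ⟨t, ht, e1⟩ := key u v h0
    rw [e1] at h
    simp only [Elt.mul] at h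
    split_ifs at h
  case vert.pair.vert =>
    obtain ⟨t, ht, e1⟩ := key u w (h ▸ h0)
    rw [e1] at h
    simp only [Elt.mul] at h
    split_ifs at h
  all_goals
    simp only [Elt.mul] at h h0
    try split_ifs at h h0
    all_goals simp_all

theorem Elt.comm {H : Hypergraph3} (x y : Elt H) : x * y = y * x := by
  simp only [Elt.mul_def]
  rcases x with _ | u | u | _ <;> rcases y with _ | v | v | _
  case vert.vert =>
    exact H.evalW_rel (.comm u v)
  case vert.pair =>
    by_cases h : u = v
    · simp only [Elt.mul, h]
    · simp only [Elt.mul, if_neg h, if_neg (Ne.symm h)]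
  case pair.vert =>
    by_cases h : u = v
    · simp only [Elt.mul, h]
    · simp only [Elt.mul, if_neg h, if_neg (Ne.symm h)]
  all_goals rfl

theorem SG.comm (H : Hypergraph3) (x y : H.SG) : x * y = y * x :=
  SG.toElt_injective H (by rw [SG.toElt_mul, SG.toElt_mul, Elt.comm])

theorem SG.cancel (H : Hypergraph3) {x y z : H.SG} (h : x * y = x * z) (h0 : x * y ≠ 0) :
    y = z := by
  refine SG.toElt_injective H (Elt.cancel (x := SG.toElt H x) ?_ ?_)
  · rw [← SG.toElt_mul, ← SG.toElt_mul, h]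
  · rw [← SG.toElt_mul]
    intro h1
    exact h0 (by rw [← SG.toSG_toElt H (x * y), h1]; rfl)

theorem SG.add_def {H : Hypergraph3} (x y : H.SG) :
    x + y = open Classical in if x = y then x else 0 := rfl

theorem SG.left_distrib' (H : Hypergraph3) (x y z : H.SG) : x * (y + z) = x * y + x * z := by
  simp only [SG.add_def]
  by_cases h : y = z
  · subst h; simp
  · rw [if_neg h, SG.mul_zero']
    split_ifs with h1
    · by_contra h2
      exact h (SG.cancel H h1 (Ne.symm h2))
    · rfl

/-- The hypergraph semiring: the hypergraph semigroup with the flat addition. -/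
noncomputable instance (H : Hypergraph3) : AISemiring H.SG where
  add_assoc x y z := by
    simp only [SG.add_def]
    by_cases h1 : x = y <;> by_cases h2 : y = z <;> simp_all
  add_comm x y := by
    simp only [SG.add_def]
    by_cases h : x = y
    · subst h; rfl
    · rw [if_neg h, if_neg (Ne.symm h)]
  left_distrib := SG.left_distrib' H
  right_distrib x y z := by
    rw [SG.comm, SG.left_distrib', SG.comm H z x, SG.comm H z y]
  add_idem x := by simp [SG.add_def]

/-- The hypergraph semiring of `H`. -/
noncomputable def semiring (H : Hypergraph3) : AISemiring.Bundled where
  carrier := H.SG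
  nonempty := ⟨0⟩

/-! # The nested-type hypergraphs -/

/-- The vertices `u_1, …, u_{3i+3}`. -/
abbrev NestedV (i : ℕ+) : Type := Set.Icc 1 (3 * (i : ℕ) + 3)

/-- The hyperedges: for `1 ≤ j ≤ i` the three sides `{u_{3j-1}, u_{3j+3}, u_{3j-2}}`,
`{u_{3j-2}, u_{3j+2}, u_{3j}}` and `{u_{3j}, u_{3j+1}, u_{3j-1}}` of the `j`-th triangle. -/
def nestedEdges (i : ℕ+) : Set (Set (NestedV i)) :=
  {e | ∃ j : ℕ, 1 ≤ j ∧ j ≤ i ∧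
    (Subtype.val '' e = ({3 * j - 1, 3 * j + 3, 3 * j - 2} : Set ℕ) ∨
     Subtype.val '' e = ({3 * j - 2, 3 * j + 2, 3 * j} : Set ℕ) ∨
     Subtype.val '' e = ({3 * j, 3 * j + 1, 3 * j - 1} : Set ℕ))}

theorem nested_side {i : ℕ+} {s : Set ℕ} (hs : s ⊆ Set.Icc 1 (3 * (i : ℕ) + 3)) :
    ∃ e : Set (NestedV i), Subtype.val '' e = s :=
  ⟨Subtype.val ⁻¹' s, by rw [Subtype.image_preimage_coe, Set.inter_eq_right.2 hs]⟩

/-- The `i`-th nested-type 3-hypergraph. -/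
def nested (i : ℕ+) : Hypergraph3 where
  V := NestedV i
  finite := inferInstance
  edges := nestedEdges i
  uniform := by
    rintro e ⟨j, hj1, hj2, h⟩
    rw [← Set.ncard_image_of_injective e Subtype.val_injective]
    rcases h with h | h | h <;> rw [h, Set.ncard_eq_three] <;>
      exact ⟨_, _, _, by omega, by omega, by omega, rfl⟩
  linear := by
    rintro e ⟨j, hj1, hj2, h⟩ f ⟨k, hk1, hk2, h'⟩ hne a ⟨hae, haf⟩ b ⟨hbe, hbf⟩
    by_contra hab
    have hab' : a.1 ≠ b.1 := fun h => hab (Subtype.ext h)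
    have a1 := Set.mem_image_of_mem Subtype.val hae
    have b1 := Set.mem_image_of_mem Subtype.val hbe
    have a2 := Set.mem_image_of_mem Subtype.val haf
    have b2 := Set.mem_image_of_mem Subtype.val hbf
    have hne' : Subtype.val '' e ≠ Subtype.val '' f := fun h =>
      hne (Subtype.val_injective.image_injective h)
    rcases h with h | h | h <;> rcases h' with h' | h' | h' <;> rw [h] at a1 b1 hne' <;>
      rw [h'] at a2 b2 hne' <;>
      simp only [Set.mem_insert_iff, Set.mem_singleton_iff] at a1 b1 a2 b2 <;>
      first
      | omega
      | (have : j = k := by omega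
         subst this
         exact hne' rfl)
  no_isolated := by
    rintro ⟨m, hm1, hm2⟩
    have key : ∀ j : ℕ, 1 ≤ j → j ≤ i → ∀ s : Set ℕ,
        (s = {3 * j - 1, 3 * j + 3, 3 * j - 2} ∨ s = {3 * j - 2, 3 * j + 2, 3 * j} ∨
          s = {3 * j, 3 * j + 1, 3 * j - 1}) → m ∈ s →
        ∃ e ∈ nestedEdges i, (⟨m, hm1, hm2⟩ : NestedV i) ∈ e := by
      intro j h1 h2 s hs hm
      have hsub : s ⊆ Set.Icc 1 (3 * (i : ℕ) + 3) := by
        intro t ht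
        rcases hs with rfl | rfl | rfl <;>
          simp only [Set.mem_insert_iff, Set.mem_singleton_iff] at ht <;>
          exact ⟨by omega, by omega⟩
      obtain ⟨e, rfl⟩ := nested_side hsub
      refine ⟨e, ⟨j, h1, h2, hs⟩, ?_⟩
      obtain ⟨x, hx, hxm⟩ := hm
      obtain rfl : x = ⟨m, hm1, hm2⟩ := Subtype.ext hxm
      exact hx
    have hi := i.pos
    by_cases hm : m ≤ 3
    · by_cases h3 : m = 3
      · exact key 1 le_rfl hi _ (.inr (.inl rfl)) (by simp; omega)
      · exact key 1 le_rfl hi _ (.inl rfl) (by simp; omega)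
    · obtain ⟨j, hj⟩ : ∃ j, m = 3 * j + 1 ∨ m = 3 * j + 2 ∨ m = 3 * j + 3 :=
        ⟨(m - 1) / 3, by omega⟩
      rcases hj with rfl | rfl | rfl
      · exact key j (by omega) (by omega) _ (.inr (.inr rfl)) (by simp)
      · exact key j (by omega) (by omega) _ (.inr (.inl rfl)) (by simp)
      · exact key j (by omega) (by omega) _ (.inl rfl) (by simp)
  nonempty := by
    have hi := i.pos
    obtain ⟨e, he⟩ := nested_side (i := i) (s := {3 * 1 - 1, 3 * 1 + 3, 3 * 1 - 2}) (by
      intro t ht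
      simp only [Set.mem_insert_iff, Set.mem_singleton_iff] at ht
      exact ⟨by omega, by omega⟩)
    exact ⟨e, 1, le_rfl, hi, .inl he⟩

end Hypergraph3

/-! ### Varieties, identities and subquotients. -/

namespace AISemiring

/-! The vertices `u_1, …, u_{3i+3}` of the nested hypergraph form consecutive triangles. A triple is
a hyperedge exactly when its residues mod 3 are distinct and its levels (triangle indices) are `k`,
`k`, `k + 1` in some order (`mem_nestedEdges`). Adding one triangle adds only hyperedges through a
new vertex, so each hypergraph is induced in the next. An induced subhypergraph gives a subquotient
of the semiring (`variety_subset_of_induced`), hence the inclusions of varieties.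

For strictness, flatness means that a sum has a nonzero value `c` only if every summand equals `c`,
and a nonzero product of three elements is a product of vertices along a hyperedge. So an assignment
making `p_1 + ⋯ + p_{i+1}` nonzero is a homomorphism from the nested hypergraph with index `i + 1`
to the one with index `i`. Either the levels climb by one at every triangle, which needs one level
more than the target has, or they are constant from triangle to triangle (`level_collapse`). In the
second case the residues also repeat, so corresponding vertices of successive triangles have the
same image (`nested_collapse`). This is exactly what makes the factors `x + y` of the `q_j` nonzero,
and then `p_j` and `q_j` agree by commutativity. In the semiring with index `i + 1` the assignment
sending each `x_k` to the element of `u_k` breaks the identity. An identity passes to the whole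
generated variety, so the inclusion is strict and the resulting chain is infinite. -/

theorem isVariety_variety (K : Set Bundled) : IsVariety (variety K) where
  image A B hA hf := fun W hW => hW.1.image A B (hA W hW) hf
  sub A B hA hf := fun W hW => hW.1.sub A B (hA W hW) hf
  prod I A hA := fun W hW => hW.1.prod I A fun i => hA i W hW

theorem subset_variety (K : Set Bundled) : K ⊆ variety K := fun _ hA _ hW => hW.2 hA

theorem variety_subset {K W : Set Bundled} (hW : IsVariety W) (h : K ⊆ W) : variety K ⊆ W :=
  Set.sInter_subset_of_mem ⟨hW, h⟩

theorem IsHom.map_eval {A B : Type} [AISemiring A] [AISemiring B] {f : A → B} (hf : IsHom f)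
    (φ : ℕ → A) (t : Expr) : f (t.eval φ) = t.eval (f ∘ φ) := by
  induction t with
  | var n => rfl
  | add s t hs ht => simp only [Expr.eval, hf.map_add, hs, ht]
  | mul s t hs ht => simp only [Expr.eval, hf.map_mul, hs, ht]

theorem isHom_apply {I : Type} (A : I → Bundled) (i : I) :
    IsHom fun f : ∀ i, (A i).carrier => f i :=
  ⟨fun _ _ => rfl, fun _ _ => rfl⟩

/-- The models of an identity form a variety. -/
theorem isVariety_models (s t : Expr) : IsVariety {A | Satisfies A s t} where
  image A B hA := by
    rintro ⟨f, hf, hs⟩ φ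
    obtain ⟨ψ, rfl⟩ : ∃ ψ, f ∘ ψ = φ :=
      ⟨fun n => (hs (φ n)).choose, funext fun n => (hs (φ n)).choose_spec⟩
    rw [← hf.map_eval, ← hf.map_eval, hA ψ]
  sub A B hA := by
    rintro ⟨f, hf, hi⟩ φ
    refine hi ?_
    rw [hf.map_eval, hf.map_eval, hA]
  prod I A hA φ := by
    funext i
    exact ((isHom_apply A i).map_eval φ s).trans
      ((hA i _).trans ((isHom_apply A i).map_eval φ t).symm)

/-- The ai-semiring structure on a subset closed under both operations. -/
abbrev subtype {A : Type} [AISemiring A] (P : A → Prop) (hadd : ∀ x y, P x → P y → P (x + y))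
    (hmul : ∀ x y, P x → P y → P (x * y)) : AISemiring {x // P x} where
  add x y := ⟨x.1 + y.1, hadd _ _ x.2 y.2⟩
  mul x y := ⟨x.1 * y.1, hmul _ _ x.2 y.2⟩
  add_assoc x y z := Subtype.ext (add_assoc x.1 y.1 z.1)
  add_comm x y := Subtype.ext (add_comm x.1 y.1)
  mul_assoc x y z := Subtype.ext (mul_assoc x.1 y.1 z.1)
  left_distrib x y z := Subtype.ext (mul_add x.1 y.1 z.1)
  right_distrib x y z := Subtype.ext (add_mul x.1 y.1 z.1)
  add_idem x := Subtype.ext (add_idem x.1)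

/-- A variety contains every homomorphic image of a subsemiring of a member. -/
theorem IsVariety.image_sub {W : Set Bundled} (hW : IsVariety W) {A B : Bundled} (hA : A ∈ W)
    (P : A.carrier → Prop) (f : A.carrier → B.carrier)
    (hadd : ∀ x y, P x → P y → P (x + y) ∧ f (x + y) = f x + f y)
    (hmul : ∀ x y, P x → P y → P (x * y) ∧ f (x * y) = f x * f y)
    (hf : ∀ b, ∃ a, P a ∧ f a = b) : B ∈ W := by
  let := subtype P (fun x y hx hy => (hadd x y hx hy).1) fun x y hx hy => (hmul x y hx hy).1
  have : Nonempty {x // P x} := B.nonempty.map fun b => ⟨_, (hf b).choose_spec.1⟩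
  have h : (⟨{x // P x}⟩ : Bundled) ∈ W :=
    hW.sub A _ hA ⟨Subtype.val, ⟨fun _ _ => rfl, fun _ _ => rfl⟩, Subtype.val_injective⟩
  exact hW.image _ B h ⟨fun x => f x.1,
    ⟨fun x y => (hadd _ _ x.2 y.2).2, fun x y => (hmul _ _ x.2 y.2).2⟩,
    fun b => ⟨⟨_, (hf b).choose_spec.1⟩, (hf b).choose_spec.2⟩⟩

end AISemiring

namespace Hypergraph3

open AISemiring

/-! ### Flat addition -/

theorem SG.add_eq_iff {H : Hypergraph3} {x y c : H.SG} (hc : c ≠ 0) :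
    x + y = c ↔ x = c ∧ y = c := by
  rw [SG.add_def]
  split_ifs with h
  · subst h; simp
  · exact ⟨fun h0 => absurd h0.symm hc, fun h' => absurd (h'.1.trans h'.2.symm) h⟩

theorem SG.sum_eval_eq_iff {H : Hypergraph3} {c : H.SG} (hc : c ≠ 0) (φ : ℕ → H.SG)
    (f : ℕ → Expr) (n : ℕ) :
    (Expr.sum f n).eval φ = c ↔ ∀ j, 1 ≤ j → j ≤ n + 1 → (f j).eval φ = c := by
  induction n with
  | zero =>
    refine ⟨fun h j h1 h2 => ?_, fun h => h 1 le_rfl le_rfl⟩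
    obtain rfl : j = 1 := by omega
    exact h
  | succ n ih =>
    change (Expr.sum f n).eval φ + (f (n + 2)).eval φ = c ↔ _
    rw [SG.add_eq_iff hc, ih]
    refine ⟨fun h j h1 h2 => ?_, fun h =>
      ⟨fun j h1 h2 => h j h1 (by omega), h _ (by omega) le_rfl⟩⟩
    rcases (by omega : j ≤ n + 1 ∨ j = n + 2) with h3 | rfl
    · exact h.1 j h1 h3
    · exact h.2

/-- Reduces an identity to its nonzero values, the only ones at which `SG.add_eq_iff` gives control
over the summands. -/
theorem SG.eq_of_ne_zero {H : Hypergraph3} {x y : H.SG} (h : ∀ c, c ≠ 0 → (x = c ↔ y = c)) :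
    x = y := by
  by_cases hx : x = 0
  · by_cases hy : y = 0
    · rw [hx, hy]
    · exact (h y hy).2 rfl
  · exact ((h x hx).1 rfl).symm

/-! ### Products of three elements -/

theorem SG.toElt_a (H : Hypergraph3) (v : H.V) : SG.toElt H (SG.a H v) = .vert v := rfl

theorem SG.toElt_zero (H : Hypergraph3) : SG.toElt H 0 = .zero := rfl

/-- Together with `SG.toSG_toElt` this makes `Elt H` a faithful normal form: nothing in the list
collapses in the presented semigroup, in particular the product along a hyperedge is not `0`. -/
theorem Elt.toElt_toSG {H : Hypergraph3} (x : Elt H) : SG.toElt H x.toSG = x := by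
  cases x with
  | zero => rfl
  | vert v => rfl
  | pair w =>
    obtain ⟨u, v, h⟩ := H.exists_pair w
    rw [Elt.toSG_pair h, SG.toElt_mul]
    exact Elt.vv h
  | top =>
    obtain ⟨e, he⟩ := H.nonempty
    obtain ⟨u, v, w, -, -, -, rfl⟩ := Set.ncard_eq_three.1 (H.uniform e he)
    rw [Elt.toSG_top he, SG.toElt_mul, SG.toElt_mul]
    exact (Elt.vvv u v w).trans (if_pos he)

/-- By degree: vertices, pairs and `top` have degrees 1, 2 and 3, and any product of degree above 3
is zero. -/
theorem Elt.vert_of_mul_ne_zero {H : Hypergraph3} {x y z : Elt H} (h : x * y * z ≠ .zero) :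
    ∃ u v w, x = .vert u ∧ y = .vert v ∧ z = .vert w := by
  simp only [Elt.mul_def] at h
  rcases x with _ | u | u | _ <;> rcases y with _ | v | v | _ <;> rcases z with _ | w | w | _
  case vert.vert.vert => exact ⟨u, v, w, rfl, rfl, rfl⟩
  all_goals
    exfalso
    apply h
    simp only [Elt.mul]
    try split_ifs
    all_goals try rfl

theorem SG.edge_of_mul_ne_zero {H : Hypergraph3} {x y z : H.SG} (h : x * y * z ≠ 0) :
    ∃ u v w, {u, v, w} ∈ H.edges ∧ x = SG.a H u ∧ y = SG.a H v ∧ z = SG.a H w := by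
  have h' : SG.toElt H x * SG.toElt H y * SG.toElt H z ≠ .zero := fun h0 => h
    (SG.toElt_injective H (by rw [SG.toElt_mul, SG.toElt_mul, h0, SG.toElt_zero]))
  obtain ⟨u, v, w, hu, hv, hw⟩ := Elt.vert_of_mul_ne_zero h'
  rw [hu, hv, hw] at h'
  refine ⟨u, v, w, ?_, SG.toElt_injective H hu, SG.toElt_injective H hv, SG.toElt_injective H hw⟩
  by_contra hE
  exact h' ((Elt.vvv u v w).trans (if_neg hE))

theorem SG.a_injective (H : Hypergraph3) : Function.Injective (SG.a H) := fun u v h => by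
  have := congrArg (SG.toElt H) h
  rw [SG.toElt_a, SG.toElt_a] at this
  injection this

/-! ### Induced subhypergraphs -/

section Induced

variable {H K : Hypergraph3} (ι : H.V → K.V)

open Classical in
/-- The partial inverse of a map of vertices, on the elements of the hypergraph semigroups: the
vertices and pairs outside the range go to `0`. -/
noncomputable def Elt.restrict : Elt K → Elt H
  | .zero => .zero
  | .vert v => if h : ∃ u, ι u = v then .vert h.choose else .zero
  | .pair v => if h : ∃ u, ι u = v then .pair h.choose else .zero
  | .top => .top

variable {ι}

theorem Elt.restrict_vert (hι : Function.Injective ι) (u : H.V) :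
    Elt.restrict ι (.vert (ι u)) = .vert u := by
  have h : ∃ u', ι u' = ι u := ⟨u, rfl⟩
  simp only [Elt.restrict, dif_pos h, hι h.choose_spec]

theorem Elt.restrict_pair (hι : Function.Injective ι) (u : H.V) :
    Elt.restrict ι (.pair (ι u)) = .pair u := by
  have h : ∃ u', ι u' = ι u := ⟨u, rfl⟩
  simp only [Elt.restrict, dif_pos h, hι h.choose_spec]

theorem Elt.restrict_pair_of_notMem {v : K.V} (h : ¬ ∃ u, ι u = v) :
    Elt.restrict ι (.pair v) = .zero := by
  simp only [Elt.restrict, dif_neg h]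

/-- Injectivity away from zero is what compatibility with the flat addition requires: distinct
elements, whose sum is `0`, may share an image only if that image is `0`. -/
theorem Elt.restrict_eq {x y : Elt K} (h : Elt.restrict ι x = Elt.restrict ι y)
    (h0 : Elt.restrict ι x ≠ .zero) : x = y := by
  have key : ∀ {u v : K.V} (hu : ∃ t, ι t = u) (hv : ∃ t, ι t = v),
      hu.choose = hv.choose → u = v := fun hu hv e =>
    hu.choose_spec.symm.trans ((congrArg ι e).trans hv.choose_spec)
  rcases x with _ | u | u | _ <;> rcases y with _ | v | v | _ <;>
    simp only [Elt.restrict] at h h0 <;> (try split_ifs at h h0) <;>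
    first
    | rfl
    | exact absurd rfl h0
    | (injection h with h; rw [key _ _ h])
    | cases h

/-- The elements without the vertices outside the range of `ι`. -/
def Elt.Inside (ι : H.V → K.V) (x : Elt K) : Prop := ∀ v, x = .vert v → ∃ u, ι u = v

theorem Elt.mul_ne_vert (x y : Elt K) (v : K.V) : x * y ≠ .vert v := by
  simp only [Elt.mul_def]
  rcases x with _ | u | u | _ <;> rcases y with _ | w | w | _ <;> simp only [Elt.mul] <;>
    (try split_ifs) <;> exact fun h => by cases h

/-- Outside vertices have to be excluded: for `v` outside the range, `vert v * pair v` is `top`,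
although both factors restrict to `0`. Outside pairs are harmless, since they annihilate every
inside vertex; they do arise as products of inside vertices whose third vertex lies outside. -/
theorem Elt.restrict_mul (hι : Function.Injective ι)
    (hE : ∀ u v w, {u, v, w} ∈ H.edges ↔ {ι u, ι v, ι w} ∈ K.edges) {x y : Elt K}
    (hx : x.Inside ι) (hy : y.Inside ι) :
    Elt.restrict ι (x * y) = Elt.restrict ι x * Elt.restrict ι y := by
  have hvp : ∀ (u : H.V) (v : K.V), Elt.restrict ι (Elt.mul (.vert (ι u)) (.pair v)) =
      Elt.mul (Elt.restrict ι (.vert (ι u))) (Elt.restrict ι (.pair v)) := by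
    intro u v
    by_cases hv : ∃ t, ι t = v
    · obtain ⟨v, rfl⟩ := hv
      rw [Elt.restrict_vert hι, Elt.restrict_pair hι]
      by_cases h : u = v
      · simp only [Elt.mul, h, Elt.restrict, if_true]
      · simp [Elt.mul, h, hι.eq_iff, Elt.restrict]
    · rw [Elt.restrict_vert hι, Elt.restrict_pair_of_notMem hv]
      have h : ι u ≠ v := fun h => hv ⟨u, h⟩
      simp [Elt.mul, h, Elt.restrict]
  rcases x with _ | u | u | _ <;> rcases y with _ | v | v | _
  case vert.vert =>
    obtain ⟨u, rfl⟩ := hx u rfl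
    obtain ⟨v, rfl⟩ := hy v rfl
    rw [Elt.restrict_vert hι, Elt.restrict_vert hι, Elt.mul_def, Elt.mul_def]
    by_cases h : ∃ w, {ι u, ι v, w} ∈ K.edges
    · obtain ⟨w, hw⟩ := h
      rw [Elt.vv hw]
      by_cases hr : ∃ t, ι t = w
      · obtain ⟨w, rfl⟩ := hr
        rw [Elt.restrict_pair hι, Elt.vv ((hE u v w).2 hw)]
      · rw [Elt.restrict_pair_of_notMem hr, Elt.vv0]
        rintro ⟨t, ht⟩
        exact hr ⟨t, K.third_unique ((hE _ _ _).1 ht) hw⟩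
    · rw [Elt.vv0 h, Elt.vv0 fun ⟨w, hw⟩ => h ⟨_, (hE _ _ _).1 hw⟩]
      rfl
  case vert.pair =>
    obtain ⟨u, rfl⟩ := hx u rfl
    exact hvp u v
  case pair.vert =>
    obtain ⟨v, rfl⟩ := hy v rfl
    rw [Elt.comm, Elt.comm (Elt.restrict ι _)]
    exact hvp v u
  all_goals
    simp only [Elt.mul_def, Elt.restrict, Elt.mul]
    try split_ifs
    all_goals rfl

/-- The semiring of an induced subhypergraph of `K` lies in the variety of the semiring of `K`. -/
theorem variety_subset_of_induced (hι : Function.Injective ι)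
    (hE : ∀ u v w, {u, v, w} ∈ H.edges ↔ {ι u, ι v, ι w} ∈ K.edges) :
    variety {H.semiring} ⊆ variety {K.semiring} := by
  refine variety_subset (isVariety_variety _) (Set.singleton_subset_iff.2 ?_)
  refine (isVariety_variety _).image_sub (A := K.semiring) (B := H.semiring)
    (subset_variety _ rfl) (fun x => (SG.toElt K x).Inside ι)
    (fun x => (Elt.restrict ι (SG.toElt K x)).toSG) ?_ ?_ ?_
  · intro (x : K.SG) (y : K.SG) hx hy
    change (SG.toElt K (x + y)).Inside ι ∧ (Elt.restrict ι (SG.toElt K (x + y))).toSG =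
      (Elt.restrict ι (SG.toElt K x)).toSG + (Elt.restrict ι (SG.toElt K y)).toSG
    by_cases h : x = y
    · subst h
      exact ⟨by rwa [AISemiring.add_idem], by rw [AISemiring.add_idem, AISemiring.add_idem]⟩
    · have h0 : x + y = (0 : K.SG) := (SG.add_def (H := K) x y).trans (if_neg h)
      rw [h0, SG.toElt_zero]
      refine ⟨fun v hv => (nomatch hv), ?_⟩
      change (0 : H.SG) = _
      rw [SG.add_def]
      -- Here `x ≠ y`, so equal images can only both be `0`, by `Elt.restrict_eq`.
      split_ifs with h1
      · by_contra h2
        have h3 := congrArg (SG.toElt H) h1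
        rw [Elt.toElt_toSG, Elt.toElt_toSG] at h3
        refine h (SG.toElt_injective K (Elt.restrict_eq h3 fun h4 => h2 ?_))
        rw [h4]; rfl
      · rfl
  · intro (x : K.SG) (y : K.SG) hx hy
    change (SG.toElt K (x * y)).Inside ι ∧ (Elt.restrict ι (SG.toElt K (x * y))).toSG =
      (Elt.restrict ι (SG.toElt K x)).toSG * (Elt.restrict ι (SG.toElt K y)).toSG
    rw [SG.toElt_mul]
    refine ⟨fun v hv => absurd hv (Elt.mul_ne_vert _ _ v), ?_⟩
    rw [Elt.restrict_mul hι hE hx hy, Elt.toSG_mul]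
  · intro (b : H.SG)
    have key : ∀ z : Elt K, z.Inside ι → Elt.restrict ι z = SG.toElt H b →
        ∃ a : K.SG, (SG.toElt K a).Inside ι ∧ (Elt.restrict ι (SG.toElt K a)).toSG = b :=
      fun z hz h => ⟨z.toSG, by rwa [Elt.toElt_toSG], by
        rw [Elt.toElt_toSG, h, SG.toSG_toElt]⟩
    rcases hb : SG.toElt H b with _ | u | u | _
    · exact key .zero (fun v hv => nomatch hv) hb.symm
    · exact key (.vert (ι u)) (fun v hv => by injection hv with hv; exact ⟨u, hv⟩)
        ((Elt.restrict_vert hι u).trans hb.symm)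
    · exact key (.pair (ι u)) (fun v hv => nomatch hv) ((Elt.restrict_pair hι u).trans hb.symm)
    · exact key .top (fun v hv => nomatch hv) hb.symm

end Induced

/-! ### Homomorphisms between nested-type hypergraphs -/

/-- Two of `a`, `b`, `c` are equal to some `k` with `1 ≤ k ≤ n`, and the third one to `k + 1`. -/
def LevelTriple (n a b c : ℕ) : Prop :=
  (a = b ∧ c = a + 1 ∨ a = c ∧ b = a + 1 ∨ b = c ∧ a = b + 1) ∧
    (1 ≤ a ∧ 1 ≤ b ∧ 1 ≤ c) ∧ a ≤ n + 1 ∧ b ≤ n + 1 ∧ c ≤ n + 1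

/-- `u_x`, `u_y`, `u_z` form a hyperedge of the `n`-th nested-type hypergraph: their residues
modulo 3 differ, two of them belong to the `k`-th triangle and one to the next. -/
def NestedTriple (n x y z : ℕ) : Prop :=
  (x % 3 ≠ y % 3 ∧ x % 3 ≠ z % 3 ∧ y % 3 ≠ z % 3) ∧
    LevelTriple n ((x + 2) / 3) ((y + 2) / 3) ((z + 2) / 3)

theorem nested_side_of_level {x y z j : ℕ} (hxy : x % 3 ≠ y % 3) (hxz : x % 3 ≠ z % 3)
    (hyz : y % 3 ≠ z % 3) (hx : (x + 2) / 3 = j) (hy : (y + 2) / 3 = j)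
    (hz : (z + 2) / 3 = j + 1) (hj : 1 ≤ j) :
    ({x, y, z} : Set ℕ) = {3 * j - 1, 3 * j + 3, 3 * j - 2} ∨
      ({x, y, z} : Set ℕ) = {3 * j - 2, 3 * j + 2, 3 * j} ∨
      ({x, y, z} : Set ℕ) = {3 * j, 3 * j + 1, 3 * j - 1} := by
  have h1 : ({x, y, z} : Set ℕ) = {x, z, y} := by rw [Set.pair_comm y z]
  have h2 : ({x, y, z} : Set ℕ) = {y, z, x} := by rw [Set.insert_comm, Set.pair_comm x z]
  rcases (by omega : z % 3 = 0 ∨ z % 3 = 1 ∨ z % 3 = 2) with h | h | h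
  · left
    rcases (by omega : x = 3 * j - 1 ∧ y = 3 * j - 2 ∨ y = 3 * j - 1 ∧ x = 3 * j - 2)
      with ⟨e1, e2⟩ | ⟨e1, e2⟩
    · rw [h1, e1, e2, (by omega : z = 3 * j + 3)]
    · rw [h2, e1, e2, (by omega : z = 3 * j + 3)]
  · right; right
    rcases (by omega : x = 3 * j ∧ y = 3 * j - 1 ∨ y = 3 * j ∧ x = 3 * j - 1)
      with ⟨e1, e2⟩ | ⟨e1, e2⟩
    · rw [h1, e1, e2, (by omega : z = 3 * j + 1)]
    · rw [h2, e1, e2, (by omega : z = 3 * j + 1)]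
  · right; left
    rcases (by omega : x = 3 * j - 2 ∧ y = 3 * j ∨ y = 3 * j - 2 ∧ x = 3 * j)
      with ⟨e1, e2⟩ | ⟨e1, e2⟩
    · rw [h1, e1, e2, (by omega : z = 3 * j + 2)]
    · rw [h2, e1, e2, (by omega : z = 3 * j + 2)]

theorem NestedTriple.swap_left {n x y z : ℕ} (h : NestedTriple n x y z) :
    NestedTriple n y x z := by
  obtain ⟨⟨d1, d2, d3⟩, hl⟩ := h
  refine ⟨⟨d1.symm, d3, d2⟩, ?_⟩
  clear d1 d2 d3
  simp only [LevelTriple] at hl ⊢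
  omega

theorem NestedTriple.swap_right {n x y z : ℕ} (h : NestedTriple n x y z) :
    NestedTriple n x z y := by
  obtain ⟨⟨d1, d2, d3⟩, hl⟩ := h
  refine ⟨⟨d2, d1, d3.symm⟩, ?_⟩
  clear d1 d2 d3
  simp only [LevelTriple] at hl ⊢
  omega

/-- The residues force `a`, `b`, `c` to be distinct, so `x`, `y`, `z` is a permutation of them, and
`NestedTriple` is symmetric. -/
theorem nestedTriple_of_eq {n x y z a b c : ℕ} (h : NestedTriple n a b c)
    (hs : ({x, y, z} : Set ℕ) = {a, b, c}) : NestedTriple n x y z := by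
  have h1 := hs.ge
  simp only [Set.insert_subset_iff, Set.singleton_subset_iff, Set.mem_insert_iff,
    Set.mem_singleton_iff] at h1
  have n1 : a ≠ b := fun e => h.1.1 (by rw [e])
  have n2 : a ≠ c := fun e => h.1.2.1 (by rw [e])
  have n3 : b ≠ c := fun e => h.1.2.2 (by rw [e])
  clear hs
  rcases h1 with ⟨rfl | rfl | rfl, rfl | rfl | rfl, rfl | rfl | rfl⟩ <;>
    first
    | exact absurd rfl n1
    | exact absurd rfl n2
    | exact absurd rfl n3
    | exact h
    | exact h.swap_left
    | exact h.swap_right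
    | exact h.swap_left.swap_right
    | exact h.swap_right.swap_left
    | exact h.swap_left.swap_right.swap_left

/-- Each triangle carries every residue once. The vertex of level `k + 1` must therefore take the
residue missing from the two of level `k`, which leaves exactly the three listed sides. This turns
questions about hyperedges into linear arithmetic. -/
theorem mem_nestedEdges {i : ℕ+} (u v w : NestedV i) :
    ({u, v, w} : Set (NestedV i)) ∈ nestedEdges i ↔ NestedTriple i u v w := by
  have him : Subtype.val '' ({u, v, w} : Set (NestedV i)) = {u.1, v.1, w.1} := by
    rw [Set.image_insert_eq, Set.image_insert_eq, Set.image_singleton]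
  change (∃ j : ℕ, _) ↔ _
  simp only [him]
  constructor
  · rintro ⟨j, h1, h2, h | h | h⟩ <;> refine nestedTriple_of_eq ?_ h <;>
      simp only [NestedTriple, LevelTriple] <;> omega
  · rintro ⟨⟨d1, d2, d3⟩, ⟨h1, h2⟩ | ⟨h1, h2⟩ | ⟨h1, h2⟩, h3, h4⟩
    · exact ⟨_, h3.1, by omega, nested_side_of_level d1 d2 d3 rfl h1.symm h2 h3.1⟩
    · rw [Set.pair_comm v.1 w.1]
      exact ⟨_, h3.1, by omega, nested_side_of_level d2 d1 d3.symm rfl h1.symm h2 h3.1⟩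
    · rw [Set.insert_comm, Set.pair_comm u.1 w.1]
      exact ⟨_, h3.2.1, by omega,
        nested_side_of_level d3 d1.symm d2.symm rfl h1.symm h2 h3.2.1⟩

/-- `a m`, `b m`, `c m` are the levels of the images of the three vertices of the `m`-th triangle,
counted from 0. In a level triple any two entries determine the third, so the levels on triangle 0
determine all the others. -/
theorem level_collapse {n : ℕ} (hn : 1 ≤ n) {a b c : ℕ → ℕ}
    (h : ∀ m, m ≤ n → LevelTriple n (b m) (c (m + 1)) (a m) ∧
      LevelTriple n (a m) (b (m + 1)) (c m) ∧ LevelTriple n (c m) (a (m + 1)) (b m)) :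
    ∀ m, m ≤ n → a m = a (m + 1) ∧ b m = b (m + 1) ∧ c m = c (m + 1) := by
  simp only [LevelTriple] at h
  -- Two equal entries may also be followed by one that is larger by 1. Three equal levels at the
  -- start would thus rise by one at each of `n + 1` steps and exceed the bound `n + 1`.
  have hne : ¬ (a 0 = b 0 ∧ b 0 = c 0) := by
    rintro ⟨e1, e2⟩
    have key : ∀ m, m ≤ n + 1 → a m = a 0 + m ∧ b m = a 0 + m ∧ c m = a 0 + m := by
      intro m
      induction m with
      | zero => intro _; omega
      | succ m ih =>
        intro hm
        have h1 := ih (by omega)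
        have h2 := h m (by omega)
        omega
    have h1 := key (n + 1) le_rfl
    have h2 := h n le_rfl
    have h3 := h 0 (by omega)
    simp only [Nat.zero_add] at h3
    omega
  -- The remaining bad pattern is `k`, `k + 1`, `k + 1`. It makes triangle 1 have levels `k + 2`,
  -- `k`, `k`, which no level triple at `m = 1` allows; this is where `1 ≤ n` enters.
  have h0 : LevelTriple n (a 0) (b 0) (c 0) := by
    have h1 := h 0 (by omega)
    have h2 := h 1 hn
    simp only [Nat.zero_add] at h1
    simp only [LevelTriple]
    omega
  simp only [LevelTriple] at h0
  -- With pattern `k`, `k`, `k + 1` on a triangle, each pair of levels has the triangle's own third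
  -- level as its completion.
  have hl : ∀ m, m ≤ n + 1 → a m = a 0 ∧ b m = b 0 ∧ c m = c 0 := by
    intro m
    induction m with
    | zero => intro _; exact ⟨rfl, rfl, rfl⟩
    | succ m ih =>
      intro hm
      have h1 := ih (by omega)
      have h2 := h m (by omega)
      omega
  intro m hm
  have h1 := hl m (by omega)
  have h2 := hl (m + 1) (by omega)
  omega

/-- A homomorphism from the `n + 1`-st to the `n`-th nested-type hypergraph maps all triangles of
the nest onto the same hyperedge. -/
theorem nested_collapse {n : ℕ} (hn : 1 ≤ n) {f : ℕ → ℕ}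
    (h : ∀ j, 1 ≤ j → j ≤ n + 1 → NestedTriple n (f (3 * j - 1)) (f (3 * j + 3)) (f (3 * j - 2)) ∧
      NestedTriple n (f (3 * j - 2)) (f (3 * j + 2)) (f (3 * j)) ∧
      NestedTriple n (f (3 * j)) (f (3 * j + 1)) (f (3 * j - 1))) :
    ∀ j, 1 ≤ j → j ≤ n + 1 → f (3 * j - 1) = f (3 * j + 2) ∧ f (3 * j - 2) = f (3 * j + 1) ∧
      f (3 * j) = f (3 * j + 3) := by
  -- Shifting `j = m + 1` removes the truncated subtractions.
  have h' : ∀ m, m ≤ n → NestedTriple n (f (3 * m + 2)) (f (3 * m + 6)) (f (3 * m + 1)) ∧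
      NestedTriple n (f (3 * m + 1)) (f (3 * m + 5)) (f (3 * m + 3)) ∧
      NestedTriple n (f (3 * m + 3)) (f (3 * m + 4)) (f (3 * m + 2)) :=
    fun m hm => h (m + 1) (by omega) (by omega)
  have hl := level_collapse hn (a := fun m => (f (3 * m + 1) + 2) / 3)
    (b := fun m => (f (3 * m + 2) + 2) / 3) (c := fun m => (f (3 * m + 3) + 2) / 3)
    fun m hm => ⟨(h' m hm).1.2, (h' m hm).2.1.2, (h' m hm).2.2.2⟩
  rintro (_ | m) h1 h2
  · omega
  obtain ⟨l1, l2, l3⟩ := hl m (by omega)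
  obtain ⟨⟨t1, -⟩, ⟨t2, -⟩, ⟨t3, -⟩⟩ := h' m (by omega)
  change f (3 * m + 2) = f (3 * m + 5) ∧ f (3 * m + 1) = f (3 * m + 4) ∧
    f (3 * m + 3) = f (3 * m + 6)
  change _ = (f (3 * m + 4) + 2) / 3 at l1
  change _ = (f (3 * m + 5) + 2) / 3 at l2
  change _ = (f (3 * m + 6) + 2) / 3 at l3
  -- The three hyperedges make the residues on the triangle pairwise distinct, so each new vertex
  -- image repeats the residue of its counterpart. Residue and level together determine a vertex.
  refine ⟨?_, ?_, ?_⟩ <;> omega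

/-! ### The separating identities -/

theorem SG.eval_pExpr_eq_iff {H : Hypergraph3} {c : H.SG} (hc : c ≠ 0) (φ : ℕ → H.SG) (j : ℕ) :
    (pExpr j).eval φ = c ↔ φ (3 * j - 1) * φ (3 * j + 3) * φ (3 * j - 2) = c ∧
      φ (3 * j - 2) * φ (3 * j + 2) * φ (3 * j) = c ∧
      φ (3 * j) * φ (3 * j + 1) * φ (3 * j - 1) = c := by
  rw [← and_assoc, ← SG.add_eq_iff hc, ← SG.add_eq_iff hc]
  rfl

/-- Once the variables are identified, the three monomials of `p_j` and the product `q_j` are all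
the same product of three elements, up to order. -/
theorem SG.eval_pExpr_eq_eval_qExpr {H : Hypergraph3} {φ : ℕ → H.SG} {j : ℕ}
    (h1 : φ (3 * j - 1) = φ (3 * j + 2)) (h2 : φ (3 * j - 2) = φ (3 * j + 1))
    (h3 : φ (3 * j) = φ (3 * j + 3)) : (pExpr j).eval φ = (qExpr j).eval φ := by
  have hp : (pExpr j).eval φ = φ (3 * j - 1) * φ (3 * j + 3) * φ (3 * j - 2) +
      φ (3 * j - 2) * φ (3 * j + 2) * φ (3 * j) +
      φ (3 * j) * φ (3 * j + 1) * φ (3 * j - 1) := rfl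
  have hq : (qExpr j).eval φ = (φ (3 * j - 1) + φ (3 * j + 2)) * (φ (3 * j - 2) + φ (3 * j + 1)) *
      (φ (3 * j) + φ (3 * j + 3)) := rfl
  rw [hp, hq, ← h1, ← h2, ← h3]
  generalize φ (3 * j - 1) = x
  generalize φ (3 * j - 2) = y
  generalize φ (3 * j) = z
  rw [AISemiring.add_idem x, AISemiring.add_idem y, AISemiring.add_idem z, SG.comm H y x, SG.comm H (z * y) x, ← mul_assoc,
    mul_assoc x z y, SG.comm H z y, ← mul_assoc, AISemiring.add_idem,
    AISemiring.add_idem]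

theorem SG.eq_of_add_ne_zero {H : Hypergraph3} {x y : H.SG} (h : x + y ≠ 0) : x = y :=
  ((SG.add_eq_iff h).1 rfl).1.trans ((SG.add_eq_iff h).1 rfl).2.symm

theorem SG.eq_of_eval_qExpr_ne_zero {H : Hypergraph3} {φ : ℕ → H.SG} {j : ℕ}
    (h : (qExpr j).eval φ ≠ 0) : φ (3 * j - 1) = φ (3 * j + 2) ∧ φ (3 * j - 2) = φ (3 * j + 1) ∧
      φ (3 * j) = φ (3 * j + 3) := by
  change (φ (3 * j - 1) + φ (3 * j + 2)) * (φ (3 * j - 2) + φ (3 * j + 1)) *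
      (φ (3 * j) + φ (3 * j + 3)) ≠ 0 at h
  refine ⟨SG.eq_of_add_ne_zero fun h0 => h ?_, SG.eq_of_add_ne_zero fun h0 => h ?_,
    SG.eq_of_add_ne_zero fun h0 => h ?_⟩
  · rw [h0, SG.zero_mul', SG.zero_mul']
  · rw [h0, SG.mul_zero', SG.zero_mul']
  · rw [h0, SG.mul_zero']

theorem nested_satisfies (i : ℕ+) :
    Satisfies (nested i).semiring (Expr.sum pExpr i) (Expr.sum qExpr i) := by
  intro (φ : ℕ → (nested i).SG)
  refine SG.eq_of_ne_zero (H := nested i) fun c hc => ?_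
  refine (SG.sum_eval_eq_iff hc φ _ _).trans (Iff.trans ?_ (SG.sum_eval_eq_iff hc φ _ _).symm)
  constructor
  · intro h
    have h' := fun j h1 h2 => (SG.eval_pExpr_eq_iff hc φ j).1 (h j h1 h2)
    have hmul : ∀ {x y z}, φ x * φ y * φ z = c → ∃ u v w : NestedV i, NestedTriple i u v w ∧
        φ x = SG.a (nested i) u ∧ φ y = SG.a (nested i) v ∧ φ z = SG.a (nested i) w := by
      intro x y z e
      obtain ⟨u, v, w, hE, huvw⟩ := SG.edge_of_mul_ne_zero (e ▸ hc)
      exact ⟨u, v, w, (mem_nestedEdges u v w).1 hE, huvw⟩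
    -- The homomorphism read off from `φ`, as a map of vertex numbers. The default `0` is no vertex
    -- number, but it conflates all non-vertices, so `hinj` below has to assume vertex values.
    let g : ℕ → ℕ := fun k => match SG.toElt (nested i) (φ k) with
      | .vert v => v.1
      | _ => 0
    have hg : ∀ {k v}, φ k = SG.a (nested i) v → g k = v.1 := by
      intro k v hk
      simp only [g, hk]
      rfl
    have hE : ∀ {x y z}, φ x * φ y * φ z = c → NestedTriple i (g x) (g y) (g z) := by
      intro x y z e
      obtain ⟨u, v, w, hE, hu, hv, hw⟩ := hmul e
      rwa [hg hu, hg hv, hg hw]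
    have hcol := nested_collapse i.pos (f := g) fun j h1 h2 =>
      ⟨hE (h' j h1 h2).1, hE (h' j h1 h2).2.1, hE (h' j h1 h2).2.2⟩
    have hinj : ∀ {k l}, (∃ u, φ k = SG.a (nested i) u) → (∃ u, φ l = SG.a (nested i) u) →
        g k = g l → φ k = φ l := by
      rintro k l ⟨u, hu⟩ ⟨v, hv⟩ e
      rw [hg hu, hg hv] at e
      rw [hu, hv, Subtype.ext e]
    intro j h1 h2
    obtain ⟨e1, e2, e3⟩ := h' j h1 h2
    obtain ⟨c1, c2, c3⟩ := hcol j h1 h2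
    obtain ⟨_, _, _, -, a1, a2, a3⟩ := hmul e1
    obtain ⟨_, _, _, -, b1, b2, b3⟩ := hmul e2
    obtain ⟨_, _, _, -, d1, d2, d3⟩ := hmul e3
    exact (SG.eval_pExpr_eq_eval_qExpr (hinj ⟨_, a1⟩ ⟨_, b2⟩ c1) (hinj ⟨_, a3⟩ ⟨_, d2⟩ c2)
      (hinj ⟨_, d1⟩ ⟨_, a2⟩ c3)).symm.trans (h j h1 h2)
  · intro h j h1 h2
    have hq := h j h1 h2
    obtain ⟨c1, c2, c3⟩ := SG.eq_of_eval_qExpr_ne_zero (hq ▸ hc)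
    exact (SG.eval_pExpr_eq_eval_qExpr c1 c2 c3).trans hq

theorem nested_succ_not_satisfies (i : ℕ+) :
    ¬ Satisfies (nested (i + 1)).semiring (Expr.sum pExpr i) (Expr.sum qExpr i) := by
  intro hs
  have hi : ((i + 1 : ℕ+) : ℕ) = i + 1 := PNat.add_coe i 1
  -- The identity on vertex numbers; the value 1 outside the range is never used, since the identity
  -- only involves `x_1, …, x_{3i+6}`.
  let g : ℕ → NestedV (i + 1) := fun k =>
    ⟨if k ∈ Set.Icc 1 (3 * ((i + 1 : ℕ+) : ℕ) + 3) then k else 1, by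
      split_ifs with h
      · exact h
      · exact ⟨le_rfl, by omega⟩⟩
  have hg : ∀ k, 1 ≤ k → k ≤ 3 * (i : ℕ) + 6 → (g k).1 = k := fun k h1 h2 =>
    if_pos ⟨h1, by omega⟩
  let φ : ℕ → (nested (i + 1)).SG := fun k => SG.a _ (g k)
  let c : (nested (i + 1)).SG := Elt.toSG .top
  have hc : c ≠ 0 := fun h => by
    have := congrArg (SG.toElt _) h
    rw [Elt.toElt_toSG] at this
    cases this
  have hE : ∀ {x y z : ℕ}, NestedTriple (i + 1) (g x).1 (g y).1 (g z).1 →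
      φ x * φ y * φ z = c := by
    intro x y z h
    rw [← hi] at h
    exact (Elt.toSG_top ((mem_nestedEdges (g x) (g y) (g z)).2 h)).symm
  have hp : (Expr.sum pExpr i).eval φ = c := by
    refine (SG.sum_eval_eq_iff hc _ _ _).2 fun j h1 h2 => (SG.eval_pExpr_eq_iff hc _ _).2
      ⟨hE ?_, hE ?_, hE ?_⟩
    all_goals
      rw [hg _ (by omega) (by omega), hg _ (by omega) (by omega), hg _ (by omega) (by omega)]
      simp only [NestedTriple, LevelTriple]
      omega
  -- The summand `q_1` already fails: its factor `x_2 + x_5` would have to be nonzero, forcing `u_2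
  -- = u_5`.
  have hq := (SG.sum_eval_eq_iff hc _ _ _).1 ((hs φ).symm.trans hp) 1 le_rfl (by omega)
  obtain ⟨h1, -⟩ := SG.eq_of_eval_qExpr_ne_zero (hq ▸ hc)
  have h2 := congrArg Subtype.val (SG.a_injective _ h1)
  change (g 2).1 = (g 5).1 at h2
  rw [hg 2 (by omega) (by omega), hg 5 (by omega) (by omega)] at h2
  omega

/-! ### The ascending chain of varieties. -/

/-- The inclusion of the vertices of a nested-type hypergraph into those of the next one. -/
def nestedIncl (i : ℕ+) (v : NestedV i) : NestedV (i + 1) :=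
  ⟨v.1, v.2.1, v.2.2.trans (by rw [PNat.add_coe]; omega)⟩

theorem nestedIncl_injective (i : ℕ+) : Function.Injective (nestedIncl i) := fun _ _ h =>
  Subtype.ext (congrArg (fun v => v.1) h :)

/-- The two predicates differ only in the upper bound on levels, and the old vertices have level at
most `n + 1`. Hence the smaller hypergraph is induced, as `variety_subset_of_induced` needs. -/
theorem nestedTriple_succ_iff {n x y z : ℕ} (hx : x ≤ 3 * n + 3) (hy : y ≤ 3 * n + 3)
    (hz : z ≤ 3 * n + 3) : NestedTriple n x y z ↔ NestedTriple (n + 1) x y z := by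
  simp only [NestedTriple, LevelTriple]
  refine and_congr_right fun _ => and_congr_right fun _ => and_congr_right fun _ => ?_
  omega

theorem variety_nested_ssubset (i : ℕ+) :
    variety {(nested i).semiring} ⊂ variety {(nested (i + 1)).semiring} := by
  refine ⟨variety_subset_of_induced (H := nested i) (K := nested (i + 1)) (ι := nestedIncl i)
    (nestedIncl_injective i) fun (u v w : NestedV i) => ?_, fun h => ?_⟩
  · exact (mem_nestedEdges u v w).trans ((nestedTriple_succ_iff u.2.2 v.2.2 w.2.2).trans
      (mem_nestedEdges (nestedIncl i u) (nestedIncl i v) (nestedIncl i w)).symm)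
  · exact nested_succ_not_satisfies i (variety_subset
      (isVariety_models (Expr.sum pExpr i) (Expr.sum qExpr i))
      (Set.singleton_subset_iff.2 (nested_satisfies i)) (h (subset_variety _ rfl)))

theorem variety_nested_subset (i : ℕ+) :
    variety {(nested i).semiring} ⊆ variety (Set.range semiring) :=
  variety_subset (isVariety_variety _)
    (Set.singleton_subset_iff.2 (subset_variety _ ⟨nested i, rfl⟩))

theorem infinite_subvarieties :
    {W : Set Bundled | IsVariety W ∧ W ⊆ variety (Set.range semiring)}.Infinite := by
  have hmono : StrictMono fun n : ℕ => variety {(nested n.succPNat).semiring} :=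
    strictMono_nat_of_lt_succ fun n => variety_nested_ssubset n.succPNat
  refine Set.infinite_of_injective_forall_mem hmono.injective fun n => ?_
  exact ⟨isVariety_variety _, variety_nested_subset _⟩

end Hypergraph3

/-- The varieties generated by the semirings of the nested-type hypergraphs form a strictly ascending
chain of subvarieties of the variety generated by all 3-uniform hypergraph semirings, which
therefore has infinitely many subvarieties; strictness is witnessed by the identities
`p_1 + ⋯ + p_{i+1} ≈ q_1 + ⋯ + q_{i+1}`. -/
theorem proposition4p5 :
    (∀ i : ℕ+, AISemiring.variety {(Hypergraph3.nested i).semiring} ⊂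
      AISemiring.variety {(Hypergraph3.nested (i + 1)).semiring}) ∧
    (∀ i : ℕ+, AISemiring.IsVariety (AISemiring.variety {(Hypergraph3.nested i).semiring}) ∧
      AISemiring.variety {(Hypergraph3.nested i).semiring} ⊆
        AISemiring.variety (Set.range Hypergraph3.semiring)) ∧
    {W : Set AISemiring.Bundled | AISemiring.IsVariety W ∧
      W ⊆ AISemiring.variety (Set.range Hypergraph3.semiring)}.Infinite ∧
    (∀ i : ℕ+,
      AISemiring.Satisfies (Hypergraph3.nested i).semiring
        (AISemiring.Expr.sum AISemiring.pExpr i) (AISemiring.Expr.sum AISemiring.qExpr i) ∧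
      ¬ AISemiring.Satisfies (Hypergraph3.nested (i + 1)).semiring
        (AISemiring.Expr.sum AISemiring.pExpr i) (AISemiring.Expr.sum AISemiring.qExpr i)) :=
  ⟨Hypergraph3.variety_nested_ssubset,
    fun i => ⟨AISemiring.isVariety_variety _, Hypergraph3.variety_nested_subset i⟩,
    Hypergraph3.infinite_subvarieties,
    fun i => ⟨Hypergraph3.nested_satisfies i, Hypergraph3.nested_succ_not_satisfies i⟩⟩
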